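/- All graphs are finite and simple. A family $\mathcal F$ of graphs (closed under isomorphism) is \emph{hereditary} if every subgraph (not necessarily induced or spanning) of a member of $\mathcal F$ is in $\mathcal F$. For a graph $G$ and a subgraph $D$ of $G$, let $G-D$ be the graph obtained from $G$ by deleting the edges of $D$, and let $$\chi_{\mathcal F}(G)=\min\{\chi(G-D) : D\subseteq G,\ D\in\mathcal F\}.$$ For $n\ge |V(G)|$, let $f(n,G|\mathcal F)$ be the smallest positive integer $k$ such that every edge coloring of $K_n$ using at least $k$ colors contains a copy of $G$ in which, for each color occurring on it, the edges of that color induce a member of $\mathcal F$ (the graph induced by a set of edges consists of these edges and their end vertices). Let $\mathrm{ex}(n,K_m)$ be the maximum number of edges of a graph on $n$ vertices that contains no $K_m$. Theorem. Let $\mathcal F$ be a nonempty hereditary family of graphs and let $G$ be a graph. In (i) and (ii) suppose also that the single edge $K_2$ belongs to $\mathcal F$. (i) If $\chi_{\mathcal F}(G)\ge 3$, then $f(n,G|\mathcal F)=(1+o(1))\,\mathrm{ex}(n,K_{\chi_{\mathcal F}(G)})$ as $n\to\infty$. (ii) If $\chi_{\mathcal F}(G)=2$, then $f(n,G|\mathcal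 F)=o(n^2)$ as $n\to\infty$. (iii) If $\chi_{\mathcal F}(G)=1$, then $f(n,G|\mathcal F)=1$ for every $n\ge |V(G)|$. -/

import Mathlib

open Filter Asymptotics

/-- A family of finite graphs, as a predicate on graphs with a finite vertex set. -/
abbrev GraphFamily : Type 1 :=
  ∀ (V : Type) [Finite V], SimpleGraph V → Prop

namespace GraphFamily

/-- A family is hereditary if it is closed under taking subgraphs. Here `H ⊑ G` says that `H` is
isomorphic to a (not necessarily induced, not necessarily spanning) subgraph of `G`, so that a
hereditary family is in particular closed under isomorphism. -/
def Hereditary (F : GraphFamily) : Prop :=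
  ∀ (V W : Type) [Finite V] [Finite W] (G : SimpleGraph V) (H : SimpleGraph W),
    H.IsContained G → F V G → F W H

/-- The `F`-deck of `G`: all graphs `G - D` obtained from `G` by deleting the edges of a
subgraph `D` of `G` that belongs to `F`. -/
def deck (F : GraphFamily) {V : Type} [Finite V] (G : SimpleGraph V) : Set (SimpleGraph V) :=
  {H | ∃ D : G.Subgraph, F D.verts D.coe ∧ H = G.deleteEdges D.edgeSet}

/-- The reduced chromatic number `χ_F(G)`: the least chromatic number of a member of the
`F`-deck of `G` (with value `0` if the deck is empty). -/
noncomputable def reducedChromaticNumber (F : GraphFamily) {V : Type} [Finite V]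
    (G : SimpleGraph V) : ℕ :=
  sInf {k : ℕ | ∃ H ∈ F.deck G, H.chromaticNumber = (k : ℕ∞)}

/-- Under the edge coloring `C` of `K_n`, the copy `φ` of `G` in `K_n` is `F`-colored: for every
color `c` occurring on it, the edges of color `c` in the copy induce a member of `F`. The coloring
is pulled back to `G`; the graph induced by a set of edges has the end vertices of these edges
(the support) as its vertices. -/
def IsFColored (F : GraphFamily) {V : Type} [Finite V] {G : SimpleGraph V} {n : ℕ}
    (C : (⊤ : SimpleGraph (Fin n)).EdgeLabeling ℕ)
    (φ : SimpleGraph.Copy G (⊤ : SimpleGraph (Fin n))) : Prop :=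
  ∀ c ∈ Set.range (C.pullback φ.toHom),
    F ((C.pullback φ.toHom).labelGraph c).support
      (((C.pullback φ.toHom).labelGraph c).induce ((C.pullback φ.toHom).labelGraph c).support)

/-- `f(n, G | F)`: the smallest positive integer `k` such that every edge coloring of `K_n` that
uses at least `k` colors contains an `F`-colored copy of `G`. (Every `k > n.choose 2` has this
property, so the minimum exists.) -/
noncomputable def forcingNumber (F : GraphFamily) (n : ℕ) {V : Type} [Finite V]
    (G : SimpleGraph V) : ℕ :=
  sInf {k : ℕ | 1 ≤ k ∧ ∀ C : (⊤ : SimpleGraph (Fin n)).EdgeLabeling ℕ,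
    k ≤ (Set.range C).ncard →
      ∃ φ : SimpleGraph.Copy G (⊤ : SimpleGraph (Fin n)), F.IsFColored C φ}

end GraphFamily

open SimpleGraph

/-! Write `r` for the reduced chromatic number. For the upper bound, pick one edge of each color. If
there are more colors than the extremal number of the complete `r`-partite graph with parts of size
`t`, this rainbow graph contains that graph. Take `D` in `F` with `G - D` properly `r`-colored, and
send each color class of vertices into its own part, choosing positions so that no edge inside a
part shares its color with an edge between parts. Each color class of the copy is then a single edge
or a subgraph of `D`. Such positions exist by a union bound. Erdős–Stone turns this into
asymptotics.

For the lower bound, make the Turán graph with `r - 1` parts rainbow and give all other edges one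
new color. Removing that color from a copy of `G` leaves an `(r - 1)`-partite graph, so its edges
cannot form a member of `F`. -/

/-- If each of finitely many events determines one coordinate of a function from the others, and
there are fewer events than values, then some function avoids all the events. -/
theorem exists_forall_not_of_card_lt {ι E : Type*} [Finite ι] [Fintype E] {t : ℕ}
    (x : E → ι) (Bad : E → (ι → Fin t) → Prop)
    (h : ∀ e f g, (∀ y, y ≠ x e → f y = g y) → Bad e f → Bad e g → f (x e) = g (x e))
    (ht : Fintype.card E < t) : ∃ f, ∀ e, ¬ Bad e f := by
  classical
  have := Fintype.ofFinite ι
  by_contra! hcon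
  -- A bad `f` can be recovered after its coordinate `x e` is overwritten, so each event holds for
  -- at most a `1 / t` fraction of all functions.
  have hcard : ∀ e, (Finset.univ.filter (Bad e)).card * t ≤ Fintype.card (ι → Fin t) := by
    intro e
    have hinj : Set.InjOn (fun q : (ι → Fin t) × Fin t => Function.update q.1 (x e) q.2)
        (((Finset.univ.filter (Bad e)) ×ˢ (Finset.univ : Finset (Fin t)) :
          Finset _) : Set ((ι → Fin t) × Fin t)) := by
      rintro ⟨f, a⟩ hf ⟨g, b⟩ hg hfg
      simp only [Finset.coe_product, Finset.coe_filter, Finset.mem_univ, true_and, Set.mem_prod,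
        Set.mem_ofPred_eq] at hf hg
      have hab : a = b := by simpa using congrFun hfg (x e)
      have hoff : ∀ y, y ≠ x e → f y = g y := fun y hy => by
        simpa [Function.update_of_ne hy] using congrFun hfg y
      have hx := h e f g hoff hf.1 hg.1
      refine Prod.ext (funext fun y => ?_) hab
      by_cases hy : y = x e
      · rw [hy]; exact hx
      · exact hoff y hy
    have := Finset.card_le_card_of_injOn _ (fun q _ => Finset.mem_univ _) hinj
    rw [Finset.card_product, Finset.card_univ, Finset.card_univ, Fintype.card_fin] at this
    exact this
  have hcover : (Finset.univ : Finset (ι → Fin t)) ⊆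
      Finset.univ.biUnion fun e => Finset.univ.filter (Bad e) := by
    intro f _
    obtain ⟨e, he⟩ := hcon f
    simp only [Finset.mem_biUnion, Finset.mem_univ, Finset.mem_filter, true_and]
    exact ⟨e, he⟩
  have h1 := (Finset.card_le_card hcover).trans Finset.card_biUnion_le
  have h2 : (∑ e, (Finset.univ.filter (Bad e)).card) * t ≤
      Fintype.card E * Fintype.card (ι → Fin t) := by
    rw [Finset.sum_mul]
    simpa using Finset.sum_le_sum fun e (_ : e ∈ Finset.univ) => hcard e
  have h3 : 0 < Fintype.card (ι → Fin t) := by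
    have : NeZero t := ⟨by lia⟩
    exact Fintype.card_pos
  rw [Finset.card_univ] at h1
  nlinarith

/-- A graph all of whose edges are edges of a subgraph `D` is contained in `D` once its isolated
vertices are removed. -/
theorem SimpleGraph.induce_support_isContained_coe {V : Type*} {G H : SimpleGraph V}
    (D : G.Subgraph) (h : ∀ a b, H.Adj a b → D.Adj a b) :
    (H.induce H.support).IsContained D.coe := by
  have hm : ∀ v ∈ H.support, v ∈ D.verts := by
    intro v hv
    obtain ⟨w, hw⟩ := hv
    exact D.edge_vert (h v w hw)
  refine ⟨⟨⟨fun v => ⟨v.1, hm v.1 v.2⟩, ?_⟩, ?_⟩⟩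
  · intro a b hab
    exact h _ _ hab
  · intro a b hab
    exact Subtype.ext (congrArg (fun z : D.verts => z.1) hab)

/-- A graph with at most one edge is contained in `K₂` once its isolated vertices are removed. -/
theorem SimpleGraph.induce_support_isContained_top_fin_two {V : Type*} {H : SimpleGraph V} {a b : V}
    (h : ∀ u v, H.Adj u v → s(u, v) = s(a, b)) :
    (H.induce H.support).IsContained (⊤ : SimpleGraph (Fin 2)) := by
  classical
  have hm : ∀ v ∈ H.support, v = a ∨ v = b := by
    rintro v ⟨w, hw⟩
    have := h v w hw
    grind
  have hinj : Function.Injective (fun v : H.support => if v.1 = a then (0 : Fin 2) else 1) := by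
    rintro ⟨u, hu⟩ ⟨v, hv⟩ huv
    have h1 := hm u hu
    have h2 := hm v hv
    apply Subtype.ext
    dsimp only at huv ⊢
    split_ifs at huv <;> simp_all
  exact ⟨⟨⟨_, fun {u v} huv => fun he => huv.ne (hinj he)⟩, hinj⟩⟩

/-! ### Erdős–Stone from its minimum-degree form -/

/-- The number of edges of a Turán-type extremal problem grows by at most the minimum degree that
forces the forbidden graph. -/
theorem SimpleGraph.extremalNumber_succ_le {W : Type*} (H : SimpleGraph W) {n : ℕ} {d : ℝ}
    (hd : 0 ≤ d)
    (h : ∀ {G : SimpleGraph (Fin (n + 1))} [DecidableRel G.Adj], d ≤ G.minDegree → H ⊑ G) :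
    (extremalNumber (n + 1) H : ℝ) ≤ extremalNumber n H + d := by
  classical
  have key := extremalNumber_le_iff_of_nonneg (V := Fin (n + 1)) (R := ℝ) H
    (m := extremalNumber n H + d) (by positivity)
  rw [Fintype.card_fin] at key
  rw [key]
  intro G _ hG
  have hlt : (G.minDegree : ℝ) < d := by
    by_contra! hcon
    exact hG (h hcon)
  obtain ⟨v, hv⟩ := G.exists_minimal_degree_vertex
  have h1 := card_edgeFinset_deleteIncidenceSet_le_extremalNumber hG v
  rw [Fintype.card_fin, Nat.add_sub_cancel, card_edgeFinset_deleteIncidenceSet] at h1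
  have h2 : G.edgeFinset.card ≤ extremalNumber n H + G.degree v := by lia
  rw [← hv] at h2
  have h3 : (G.edgeFinset.card : ℝ) ≤ extremalNumber n H + G.minDegree := by exact_mod_cast h2
  linarith

/-- The exact edge count with denominators cleared: `q ^ 2` absorbs `(n % q) ^ 2`, and the `+ 1`
absorbs the rounding of the division. -/
theorem SimpleGraph.le_card_edgeFinset_turanGraph {n q : ℕ} (hq : 0 < q) :
    ((n : ℝ) ^ 2 - q ^ 2) * (q - 1) ≤ 2 * q * ((turanGraph n q).edgeFinset.card + 1) := by
  rcases le_total n q with hnq | hnq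
  · have h1 : ((n : ℝ) ^ 2 - q ^ 2) ≤ 0 := by
      have : (n : ℝ) ≤ q := by exact_mod_cast hnq
      nlinarith [(Nat.cast_nonneg n : (0 : ℝ) ≤ n)]
    have h2 : (0 : ℝ) ≤ q - 1 := by
      have : (1 : ℝ) ≤ q := by exact_mod_cast hq
      linarith
    exact (mul_nonpos_of_nonpos_of_nonneg h1 h2).trans (by positivity)
  have h1 : (n ^ 2 - q ^ 2) * (q - 1) ≤ 2 * q * ((turanGraph n q).edgeFinset.card + 1) := by
    rw [card_edgeFinset_turanGraph]
    have hm : (n ^ 2 - q ^ 2) * (q - 1) ≤ (n ^ 2 - (n % q) ^ 2) * (q - 1) := by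
      gcongr
      exact (Nat.mod_lt n hq).le
    refine hm.trans ?_
    generalize (n ^ 2 - (n % q) ^ 2) * (q - 1) = X
    have := Nat.div_add_mod X (2 * q)
    have := Nat.mod_lt X (show 0 < 2 * q by lia)
    nlinarith [Nat.zero_le ((n % q).choose 2)]
  have hsq : q ^ 2 ≤ n ^ 2 := Nat.pow_le_pow_left hnq 2
  have h2 : (((n ^ 2 - q ^ 2) * (q - 1) : ℕ) : ℝ) ≤
    ((2 * q * ((turanGraph n q).edgeFinset.card + 1) : ℕ) : ℝ) := by exact_mod_cast h1
  push_cast [Nat.cast_sub hsq, Nat.cast_sub (show 1 ≤ q from hq)] at h2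
  exact h2

/-- The **Erdős-Stone theorem**: asymptotically, forbidding a complete equipartite graph in `q + 1`
parts allows no more edges than forbidding a complete graph on `q + 1` vertices. -/
theorem SimpleGraph.eventually_extremalNumber_completeEquipartiteGraph_le {q : ℕ} (hq : 0 < q)
    (t : ℕ) {ε : ℝ} (hε : 0 < ε) :
    ∀ᶠ n : ℕ in atTop, (extremalNumber n (completeEquipartiteGraph (q + 1) t) : ℝ) ≤
      (turanGraph n q).edgeFinset.card + ε * (n : ℝ) ^ 2 := by
  obtain ⟨N, hN⟩ := eventually_atTop.mp
    (eventually_completeEquipartiteGraph_isContained_of_minDegree hε q t)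
  set H := completeEquipartiteGraph (q + 1) t
  have hq1 : (1 : ℝ) ≤ q := by exact_mod_cast hq
  have hq2 : (1 : ℝ) / q ≤ 1 := by rw [div_le_one (by positivity)]; exact hq1
  set α : ℝ := 1 - 1 / q with hα
  have hα0 : 0 ≤ α := by linarith
  have hα1 : α ≤ 1 := by
    have : (0 : ℝ) ≤ 1 / q := by positivity
    linarith
  set K : ℝ := (extremalNumber N H : ℝ) with hK
  -- Sums the degree thresholds `(α + ε) * m` over `m ≤ n`.
  have hrec : ∀ n, N ≤ n → (extremalNumber n H : ℝ) ≤ K + (α + ε) * (n * (n + 1) / 2) := by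
    intro n hn
    induction n, hn using Nat.le_induction with
    | base =>
      have : 0 ≤ (α + ε) * ((N : ℝ) * (N + 1) / 2) := by positivity
      linarith
    | succ n hn ih =>
      have h1 := extremalNumber_succ_le H (n := n) (d := (α + ε) * (n + 1 : ℕ)) (by positivity)
        (fun {G} _ hG => hN (n + 1) (by lia) hG)
      push_cast at h1 ⊢
      linarith
  have hlow : ∀ n : ℕ, α * ((n : ℝ) ^ 2 - q ^ 2) / 2 - 1 ≤ (turanGraph n q).edgeFinset.card := by
    intro n
    have h := le_card_edgeFinset_turanGraph (n := n) hq
    have h' : α * ((n : ℝ) ^ 2 - q ^ 2) / 2 = (((n : ℝ) ^ 2 - q ^ 2) * (q - 1)) / (2 * q) := by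
      rw [hα]; field_simp
    rw [h', sub_le_iff_le_add, div_le_iff₀ (by positivity)]
    linarith
  -- The recursion spends only half of `ε * n ^ 2`; the other half must absorb the constant and
  -- linear terms.
  obtain ⟨M, hM⟩ := exists_nat_gt ((K + 1 + q ^ 2 + (1 + ε)) / (ε / 2))
  filter_upwards [eventually_ge_atTop (max N (M + 1))] with n hn
  have hnN : N ≤ n := (le_max_left _ _).trans hn
  have hnM : (M : ℝ) + 1 ≤ n := by exact_mod_cast (le_max_right _ _).trans hn
  rw [div_lt_iff₀ (by positivity)] at hM
  have h1 := hrec n hnN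
  have h2 := hlow n
  have hn1 : (1 : ℝ) ≤ n := by linarith [(Nat.cast_nonneg M : (0 : ℝ) ≤ M)]
  have h3 : K + 1 + q ^ 2 + (1 + ε) ≤ ε / 2 * n := by nlinarith
  have hK0 : 0 ≤ K := by positivity
  have h4 : (K + 1 + q ^ 2 + (1 + ε)) * n ≤ ε / 2 * (n : ℝ) ^ 2 := by nlinarith
  have h5 : (K + 1 + q ^ 2) ≤ (K + 1 + (q : ℝ) ^ 2) * n :=
    le_mul_of_one_le_right (by positivity) hn1
  have h6 : α * n ≤ n := mul_le_of_le_one_left (by positivity) hα1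
  have h7 : α * (q : ℝ) ^ 2 ≤ q ^ 2 := mul_le_of_le_one_left (by positivity) hα1
  have h8 : 0 ≤ (q : ℝ) ^ 2 := by positivity
  nlinarith

/-! ### Reduced chromatic number and forcing number -/

namespace GraphFamily

variable {F : GraphFamily} {V : Type} [Fintype V] {G : SimpleGraph V} {n : ℕ}

theorem exists_colorable_of_reducedChromaticNumber_pos (h : 0 < F.reducedChromaticNumber G) :
    ∃ D : G.Subgraph, F D.verts D.coe ∧
      (G.deleteEdges D.edgeSet).Colorable (F.reducedChromaticNumber G) := by
  have hne : {k : ℕ | ∃ H ∈ F.deck G, H.chromaticNumber = (k : ℕ∞)}.Nonempty := by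
    by_contra hcon
    rw [Set.not_nonempty_iff_eq_empty] at hcon
    rw [reducedChromaticNumber, hcon, Nat.sInf_empty] at h
    exact h.false
  obtain ⟨H, ⟨D, hD, rfl⟩, hH⟩ := Nat.sInf_mem hne
  exact ⟨D, hD, chromaticNumber_le_iff_colorable.mp hH.le⟩

theorem reducedChromaticNumber_le_of_colorable {D : G.Subgraph} (hD : F D.verts D.coe) {k : ℕ}
    (h : (G.deleteEdges D.edgeSet).Colorable k) : F.reducedChromaticNumber G ≤ k := by
  obtain ⟨m, hm⟩ := ENat.ne_top_iff_exists.mp (chromaticNumber_ne_top_iff_exists.mpr ⟨k, h⟩)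
  have h1 : F.reducedChromaticNumber G ≤ m := Nat.sInf_le ⟨_, ⟨D, hD, rfl⟩, hm.symm⟩
  have h2 := chromaticNumber_le_iff_colorable.mpr h
  rw [← hm] at h2
  exact h1.trans (by exact_mod_cast h2)

theorem forcingNumber_le {k : ℕ} (hk : 1 ≤ k)
    (h : ∀ C : (⊤ : SimpleGraph (Fin n)).EdgeLabeling ℕ, k ≤ (Set.range C).ncard →
      ∃ φ : SimpleGraph.Copy G (⊤ : SimpleGraph (Fin n)), F.IsFColored C φ) :
    F.forcingNumber n G ≤ k :=
  Nat.sInf_le ⟨hk, h⟩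

theorem forcingNumber_mem : F.forcingNumber n G ∈
    {k : ℕ | 1 ≤ k ∧ ∀ C : (⊤ : SimpleGraph (Fin n)).EdgeLabeling ℕ,
      k ≤ (Set.range C).ncard →
        ∃ φ : SimpleGraph.Copy G (⊤ : SimpleGraph (Fin n)), F.IsFColored C φ} := by
  refine Nat.sInf_mem ⟨Nat.card (⊤ : SimpleGraph (Fin n)).edgeSet + 1, by lia, fun C hC => ?_⟩
  have h := Finite.card_range_le C
  rw [Nat.card_coe_set_eq] at h
  lia

theorem lt_forcingNumber (C : (⊤ : SimpleGraph (Fin n)).EdgeLabeling ℕ)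
    (h : ∀ φ : SimpleGraph.Copy G (⊤ : SimpleGraph (Fin n)), ¬ F.IsFColored C φ) :
    (Set.range C).ncard < F.forcingNumber n G := by
  by_contra! hcon
  obtain ⟨φ, hφ⟩ := (forcingNumber_mem (F := F) (G := G) (n := n)).2 C hcon
  exact h φ hφ

theorem forcingNumber_eq_one_of_reducedChromaticNumber_eq_one (hF : F.Hereditary)
    (h : F.reducedChromaticNumber G = 1) (hn : Fintype.card V ≤ n) : F.forcingNumber n G = 1 := by
  refine le_antisymm (forcingNumber_le le_rfl fun C _ => ?_) forcingNumber_mem.1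
  obtain ⟨D, hD, hcol⟩ := exists_colorable_of_reducedChromaticNumber_pos (F := F) (G := G) (by lia)
  rw [h] at hcol
  obtain ⟨p⟩ := hcol
  obtain ⟨e⟩ := Function.Embedding.nonempty_of_card_le (α := V) (β := Fin n) (by simpa using hn)
  refine ⟨⟨⟨e, fun hab => fun he => hab.ne (e.injective he)⟩, e.injective⟩, fun c _ => ?_⟩
  refine hF _ _ _ _ (induce_support_isContained_coe D fun a b hab => ?_) hD
  by_contra hDab
  exact p.valid (v := a) (w := b)
    (deleteEdges_adj.mpr ⟨EdgeLabeling.labelGraph_le _ hab, hDab⟩) (Subsingleton.elim _ _)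

/-! ### Upper bound: rainbow multipartite subgraphs -/

/-- Every coloring of a graph has a rainbow subgraph containing one edge of each color. -/
theorem exists_rainbow_subgraph {K : Type*} (C : (⊤ : SimpleGraph (Fin n)).EdgeLabeling K) :
    ∃ R : SimpleGraph (Fin n), R.edgeSet.ncard = (Set.range C).ncard ∧
      ∀ e ∈ R.edgeSet, ∀ e' ∈ R.edgeSet, ∀ (h : e ∈ (⊤ : SimpleGraph (Fin n)).edgeSet)
        (h' : e' ∈ (⊤ : SimpleGraph (Fin n)).edgeSet), C ⟨e, h⟩ = C ⟨e', h'⟩ → e = e' := by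
  classical
  let σ : Set.range C → (⊤ : SimpleGraph (Fin n)).edgeSet := fun c => c.2.choose
  have hσ : ∀ c, C (σ c) = c.1 := fun c => c.2.choose_spec
  have hset : (fromEdgeSet (Set.range fun c => (σ c).1)).edgeSet = Set.range fun c => (σ c).1 := by
    rw [edgeSet_fromEdgeSet, sdiff_eq_left, Set.disjoint_left]
    rintro _ ⟨c, rfl⟩ hc
    exact not_isDiag_of_mem_edgeSet _ (σ c).2 hc
  refine ⟨fromEdgeSet (Set.range fun c => (σ c).1), ?_, ?_⟩
  · have hinj : Function.Injective fun c => (σ c).1 := by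
      intro c d hcd
      apply Subtype.ext
      rw [← hσ c, ← hσ d, Subtype.ext hcd]
    rw [hset, ← Set.image_univ, Set.ncard_image_of_injective _ hinj, Set.ncard_univ]
    rfl
  · rw [hset]
    rintro _ ⟨c, rfl⟩ _ ⟨d, rfl⟩ h h' hcd
    have : c = d := Subtype.ext (by rw [← hσ c, ← hσ d]; exact hcd)
    rw [this]

/-- A large enough complete equipartite rainbow subgraph, with as many parts as the reduced
chromatic number of `G`, forces an `F`-colored copy of `G`. -/
theorem exists_isFColored_of_rainbow (hF : F.Hereditary)
    (hK : F (Fin 2) (⊤ : SimpleGraph (Fin 2))) {r t : ℕ} {D : G.Subgraph} (hD : F D.verts D.coe)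
    (p : (G.deleteEdges D.edgeSet).Coloring (Fin r))
    (ht : Fintype.card ((V × V) ⊕ (V × V × V × V)) < t)
    (C : (⊤ : SimpleGraph (Fin n)).EdgeLabeling ℕ) {R : SimpleGraph (Fin n)}
    (hR : ∀ e ∈ R.edgeSet, ∀ e' ∈ R.edgeSet, ∀ (h : e ∈ (⊤ : SimpleGraph (Fin n)).edgeSet)
        (h' : e' ∈ (⊤ : SimpleGraph (Fin n)).edgeSet), C ⟨e, h⟩ = C ⟨e', h'⟩ → e = e')
    (ψ : (completeEquipartiteGraph r t).Copy R) :
    ∃ φ : SimpleGraph.Copy G (⊤ : SimpleGraph (Fin n)), F.IsFColored C φ := by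
  classical
  let k : Sym2 (Fin n) → ℕ := fun e => if h : e ∈ (⊤ : SimpleGraph (Fin n)).edgeSet then C ⟨e, h⟩
    else 0
  have hRk : ∀ e ∈ R.edgeSet, ∀ e' ∈ R.edgeSet, k e = k e' → e = e' := by
    intro e he e' he' hk
    have h := edgeSet_mono (le_top : R ≤ ⊤) he
    have h' := edgeSet_mono (le_top : R ≤ ⊤) he'
    refine hR e he e' he' h h' ?_
    simpa only [k, dif_pos h, dif_pos h'] using hk
  have hψ : ∀ a b, a.1 ≠ b.1 → s(ψ a, ψ b) ∈ R.edgeSet := fun a b hab =>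
    ψ.toHom.map_adj (v := a) (w := b) hab
  have hψi : Function.Injective ψ := ψ.injective
  -- Two kinds of bad event: two vertices collide, or a pair `a, b` in one part matches the color of
  -- a crossing edge `c d`. In the latter, the color fixes the edge of the rainbow graph, hence the
  -- position of `d` given the others, provided `d` is neither `a` nor `b`.
  obtain ⟨f, hf⟩ := exists_forall_not_of_card_lt (ι := V) (t := t)
    (E := (V × V) ⊕ (V × V × V × V))
    (Sum.elim (fun e => e.2) (fun e => e.2.2.2))
    (Sum.elim (fun e f => e.1 ≠ e.2 ∧ p e.1 = p e.2 ∧ f e.1 = f e.2)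
      (fun e f => p e.1 = p e.2.1 ∧ p e.2.2.1 ≠ p e.2.2.2 ∧
        e.2.2.2 ≠ e.1 ∧ e.2.2.2 ≠ e.2.1 ∧
        k s(ψ (p e.1, f e.1), ψ (p e.2.1, f e.2.1)) =
          k s(ψ (p e.2.2.1, f e.2.2.1), ψ (p e.2.2.2, f e.2.2.2))))
    (by
      rintro (⟨a, b⟩ | ⟨a, b, c, d⟩) f g hfg hef heg
      · simp only [Sum.elim_inl] at hfg hef heg ⊢
        rw [← hef.2.2, ← heg.2.2]
        exact hfg a hef.1
      · simp only [Sum.elim_inr] at hfg hef heg ⊢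
        obtain ⟨-, hcd, hda, hdb, hef⟩ := hef
        obtain ⟨-, -, -, -, heg⟩ := heg
        have hc : c ≠ d := fun h => hcd (by rw [h])
        rw [hfg a hda.symm, hfg b hdb.symm, heg, hfg c hc] at hef
        have := hRk _ (hψ _ _ hcd) _ (hψ _ _ hcd) hef
        rw [Sym2.congr_right] at this
        exact (congrArg Prod.snd (hψi this)).symm)
    ht
  have hinj : Function.Injective fun v => ψ (p v, f v) := by
    intro a b hab
    have := hψi hab
    by_contra hne
    exact hf (.inl (a, b)) ⟨hne, congrArg Prod.fst this, congrArg Prod.snd this⟩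
  have hgood : ∀ a b c d, a ≠ b → p a = p b → p c ≠ p d →
      k s(ψ (p a, f a), ψ (p b, f b)) ≠ k s(ψ (p c, f c), ψ (p d, f d)) := by
    intro a b c d hab hpab hpcd hk
    -- At most one end of a crossing edge lies in `{a, b}`, so swapping its ends if needed frees the
    -- last coordinate.
    by_cases hd : d = a ∨ d = b
    · have hpd : p d = p a := by
        rcases hd with rfl | rfl
        · rfl
        · exact hpab.symm
      have hc : c ≠ a ∧ c ≠ b :=
        ⟨fun h => hpcd (by rw [h, hpd]), fun h => hpcd (by rw [h, hpd, hpab])⟩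
      exact hf (.inr (a, b, d, c)) ⟨hpab, hpcd.symm, hc.1, hc.2, by
        simp only; rw [hk, Sym2.eq_swap]⟩
    · push Not at hd
      exact hf (.inr (a, b, c, d)) ⟨hpab, hpcd, hd.1, hd.2, hk⟩
  let φ : SimpleGraph.Copy G (⊤ : SimpleGraph (Fin n)) :=
    ⟨⟨fun v => ψ (p v, f v), fun hab => fun he => hab.ne (hinj he)⟩, hinj⟩
  refine ⟨φ, fun c _ => ?_⟩
  have hcol : ∀ a b, ((C.pullback φ.toHom).labelGraph c).Adj a b →
      G.Adj a b ∧ k s(ψ (p a, f a), ψ (p b, f b)) = c := by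
    intro a b hab
    obtain ⟨hG, hc⟩ := (EdgeLabeling.labelGraph_adj _ _).mp hab
    refine ⟨hG, ?_⟩
    have h : s(ψ (p a, f a), ψ (p b, f b)) ∈ (⊤ : SimpleGraph (Fin n)).edgeSet :=
      φ.toHom.map_adj hG
    simp only [k, dif_pos h]
    exact hc
  by_cases hcross : ∃ a b, ((C.pullback φ.toHom).labelGraph c).Adj a b ∧ p a ≠ p b
  · obtain ⟨a, b, hab, hpab⟩ := hcross
    refine hF _ _ _ _ (induce_support_isContained_top_fin_two (a := a) (b := b) ?_) hK
    intro u v huv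
    have hk := (hcol u v huv).2.trans (hcol a b hab).2.symm
    by_cases hpuv : p u = p v
    · exact absurd hk (hgood u v a b huv.ne hpuv hpab)
    · have := hRk _ (hψ _ _ hpuv) _ (hψ _ _ hpab) hk
      exact Sym2.map.injective hinj this
  · push Not at hcross
    refine hF _ _ _ _ (induce_support_isContained_coe D fun a b hab => ?_) hD
    by_contra hDab
    exact p.valid (deleteEdges_adj.mpr ⟨(hcol a b hab).1, hDab⟩) (hcross a b hab)

theorem exists_forcingNumber_le_extremalNumber (hF : F.Hereditary)
    (hK : F (Fin 2) (⊤ : SimpleGraph (Fin 2))) (h : 0 < F.reducedChromaticNumber G) :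
    ∃ t, ∀ n, F.forcingNumber n G ≤
      extremalNumber n (completeEquipartiteGraph (F.reducedChromaticNumber G) t) + 1 := by
  classical
  obtain ⟨D, hD, ⟨p⟩⟩ := exists_colorable_of_reducedChromaticNumber_pos h
  refine ⟨Fintype.card ((V × V) ⊕ (V × V × V × V)) + 1, fun n =>
    forcingNumber_le (by lia) fun C hC => ?_⟩
  obtain ⟨R, hcard, hR⟩ := exists_rainbow_subgraph C
  obtain ⟨ψ⟩ := IsContained.of_extremalNumber_lt_card_edgeFinset (G := R)
    (H := completeEquipartiteGraph (F.reducedChromaticNumber G)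
      (Fintype.card ((V × V) ⊕ (V × V × V × V)) + 1)) (by
    rw [Fintype.card_fin, ← Set.ncard_coe_finset, coe_edgeFinset, hcard]
    lia)
  exact exists_isFColored_of_rainbow hF hK hD p (Nat.lt_succ_self _) C hR ψ

/-! ### Lower bound: the Turán coloring -/

/-- Coloring the edges of a Turán graph with distinct colors and all other edges with one further
color yields no `F`-colored copy of `G`. -/
theorem card_edgeFinset_turanGraph_lt_forcingNumber (hF : F.Hereditary)
    (hK : F (Fin 2) (⊤ : SimpleGraph (Fin 2))) {q : ℕ} (hq : 0 < q)
    (h : q < F.reducedChromaticNumber G) (n : ℕ) :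
    (turanGraph n q).edgeFinset.card < F.forcingNumber n G := by
  classical
  obtain ⟨ι, hι⟩ := Countable.exists_injective_nat (Sym2 (Fin n))
  let C : (⊤ : SimpleGraph (Fin n)).EdgeLabeling ℕ := fun e =>
    if e.1 ∈ (turanGraph n q).edgeSet then ι e.1 + 1 else 0
  refine lt_of_le_of_lt ?_ (lt_forcingNumber C fun φ hφ => ?_)
  · have hsub : (fun e => ι e + 1) '' (turanGraph n q).edgeSet ⊆ Set.range C := by
      rintro _ ⟨e, he, rfl⟩
      exact ⟨⟨e, edgeSet_mono le_top he⟩, if_pos he⟩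
    have := Set.ncard_le_ncard hsub (Set.finite_range C)
    rwa [Set.ncard_image_of_injective _ (fun a b hab => hι (by simpa using hab)), ← coe_edgeFinset,
      Set.ncard_coe_finset] at this
  · set H := (C.pullback φ.toHom).labelGraph 0 with hH
    let D : G.Subgraph :=
      { verts := H.support
        Adj := H.Adj
        adj_sub := fun hab => EdgeLabeling.labelGraph_le _ hab
        edge_vert := fun {a b} hab => ⟨b, hab⟩
        symm := H.symm }
    have hD : F D.verts D.coe := by
      -- If color `0` misses the copy, `D` is empty and belongs to `F` as a subgraph of `K₂`.
      by_cases h0 : (0 : ℕ) ∈ Set.range (C.pullback φ.toHom)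
      · refine hF _ _ _ _ ⟨⟨⟨id, fun hab => hab⟩, Function.injective_id⟩⟩ (hφ 0 h0)
      · refine hF _ _ _ _ ?_ hK
        have : IsEmpty D.verts := by
          refine ⟨fun ⟨v, w, hvw⟩ => h0 ?_⟩
          obtain ⟨hG, hc⟩ := (EdgeLabeling.labelGraph_adj _ _).mp hvw
          exact ⟨_, hc⟩
        exact IsContained.of_isEmpty
    refine absurd (reducedChromaticNumber_le_of_colorable (k := q) hD ?_) (by lia)
    refine ⟨Coloring.mk (fun v => ⟨(φ v : ℕ) % q, Nat.mod_lt _ hq⟩) ?_⟩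
    intro a b hab heq
    obtain ⟨hG, hDab⟩ := deleteEdges_adj.mp hab
    refine hDab ((EdgeLabeling.labelGraph_adj _ _).mpr ⟨hG, if_neg ?_⟩)
    intro hT
    exact hT (congrArg Fin.val heq)

end GraphFamily

/-! ### Asymptotics -/

theorem mainTheorem1 (F : GraphFamily) (hF : F.Hereditary)
    {V : Type} [Fintype V] (G : SimpleGraph V) :
    (F (Fin 2) (⊤ : SimpleGraph (Fin 2)) → 3 ≤ F.reducedChromaticNumber G →
      (fun n : ℕ => (F.forcingNumber n G : ℝ)) ~[atTop]
        (fun n : ℕ => (SimpleGraph.extremalNumber n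
          (⊤ : SimpleGraph (Fin (F.reducedChromaticNumber G))) : ℝ))) ∧
    (F (Fin 2) (⊤ : SimpleGraph (Fin 2)) → F.reducedChromaticNumber G = 2 →
      (fun n : ℕ => (F.forcingNumber n G : ℝ)) =o[atTop] (fun n : ℕ => (n : ℝ) ^ 2)) ∧
    (F.reducedChromaticNumber G = 1 →
      ∀ n : ℕ, Fintype.card V ≤ n → F.forcingNumber n G = 1) := by
  have upper : F (Fin 2) (⊤ : SimpleGraph (Fin 2)) → ∀ q, 0 < q →
      F.reducedChromaticNumber G = q + 1 → ∀ ε : ℝ, 0 < ε → ∀ᶠ n : ℕ in atTop,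
        (F.forcingNumber n G : ℝ) ≤ (turanGraph n q).edgeFinset.card + ε * (n : ℝ) ^ 2 := by
    intro hK q hq hr ε hε
    obtain ⟨t, ht⟩ := GraphFamily.exists_forcingNumber_le_extremalNumber (G := G) hF hK (by lia)
    rw [hr] at ht
    obtain ⟨N, hN⟩ := exists_nat_gt (2 / ε)
    filter_upwards [eventually_extremalNumber_completeEquipartiteGraph_le hq t (half_pos hε),
      eventually_ge_atTop (N + 1)] with n hn hnN
    have h1 : (F.forcingNumber n G : ℝ) ≤
        extremalNumber n (completeEquipartiteGraph (q + 1) t) + 1 := by exact_mod_cast ht n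
    have h2 : (N : ℝ) + 1 ≤ n := by exact_mod_cast hnN
    rw [div_lt_iff₀ hε] at hN
    have h3 : (1 : ℝ) ≤ n := by linarith [(Nat.cast_nonneg N : (0 : ℝ) ≤ N)]
    nlinarith
  refine ⟨fun hK hr => ?_, fun hK hr => ?_, fun hr n hn =>
    GraphFamily.forcingNumber_eq_one_of_reducedChromaticNumber_eq_one hF hr hn⟩
  · obtain ⟨q, hq⟩ : ∃ q, F.reducedChromaticNumber G = q + 1 := ⟨_, (Nat.succ_pred_eq_of_pos
      (by lia)).symm⟩
    have hq2 : 2 ≤ q := by lia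
    have hlow := GraphFamily.card_edgeFinset_turanGraph_lt_forcingNumber (G := G) hF hK
      (q := q) (by lia) (by lia)
    have hex : ∀ n, extremalNumber n (⊤ : SimpleGraph (Fin (F.reducedChromaticNumber G))) =
        (turanGraph n q).edgeFinset.card := by
      intro n
      rw [hq]
      have : Nontrivial (Fin (q + 1)) := Fin.nontrivial_iff_two_le.mpr (by lia)
      convert! extremalNumber_top (n := n) (α := Fin (q + 1))
      rw [Fintype.card_fin, Nat.add_sub_cancel]
    simp only [hex]
    rw [IsEquivalent, isLittleO_iff]
    intro c hc
    -- Large enough that the Turán graph has at least `n ^ 2 / 8` edges, so an error of `c / 8 * n ^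
    -- 2` is at most `c` times its size.
    obtain ⟨N, hN⟩ := exists_nat_gt ((q : ℝ) ^ 2 * 2 + 8)
    filter_upwards [upper hK q (by lia) hq (c / 8) (by positivity), eventually_ge_atTop N]
      with n hn hnN
    have h1 : ((turanGraph n q).edgeFinset.card : ℝ) ≤ F.forcingNumber n G := by
      exact_mod_cast (hlow n).le
    have h2 : (n : ℝ) ^ 2 / 8 ≤ (turanGraph n q).edgeFinset.card := by
      have h := le_card_edgeFinset_turanGraph (n := n) (q := q) (by lia)
      have h3 : (N : ℝ) ≤ n := by exact_mod_cast hnN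
      have hq2' : (2 : ℝ) ≤ q := by exact_mod_cast hq2
      have h4 : (q : ℝ) ^ 2 * 2 + 8 ≤ (n : ℝ) ^ 2 := by nlinarith
      have h5 : ((n : ℝ) ^ 2 - q ^ 2) * (q / 2) ≤ ((n : ℝ) ^ 2 - q ^ 2) * (q - 1) :=
        mul_le_mul_of_nonneg_left (by linarith) (by nlinarith)
      have h6 : (q : ℝ) * (((n : ℝ) ^ 2 - q ^ 2) / 2) ≤
          q * (2 * ((turanGraph n q).edgeFinset.card + 1)) := by linarith
      have h7 := le_of_mul_le_mul_left h6 (by linarith)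
      linarith
    rw [Pi.sub_apply, Real.norm_of_nonneg (by linarith), Real.norm_of_nonneg (by positivity)]
    nlinarith
  · rw [isLittleO_iff]
    intro c hc
    filter_upwards [upper hK 1 one_pos hr c hc] with n hn
    have h0 : (turanGraph n 1).edgeFinset.card = 0 := by
      simp [card_edgeFinset_turanGraph, Nat.mod_one]
    rw [h0, Nat.cast_zero, zero_add] at hn
    rw [Real.norm_of_nonneg (by positivity), Real.norm_of_nonneg (by positivity)]
    exact hn
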